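/- Let $(\mathcal A;\mathcal E)$ be a Frobenius category, i.e. an additive category with a Quillen exact structure that has enough projective and enough injective objects and whose projective and injective objects coincide. Let $\underline{\mathcal A}$ be its stable category ($\underline{\mathrm{Hom}}(A,B)$ is $\mathrm{Hom}(A,B)$ modulo the morphisms that factor through a projective object), $\pi\colon\mathcal A\to\underline{\mathcal A}$ the quotient functor, and for each object $A$ fix a conflation $A\to E_A\to\Sigma(A)$ with $E_A$ injective; $A\mapsto\pi(\Sigma(A))$ is the cosyzygy functor $\mathcal A\to\underline{\mathcal A}$. Both functors are additive, full and dense, and $\pi(\mathcal I)$, $\pi(\Sigma(\mathcal J))$ denote the ideals of $\underline{\mathcal A}$ that are the images (closed under isomorphism) of ideals $\mathcal I$, $\mathcal J$ of $\mathcal A$ under $\pi$ and under the cosyzygy functor, respectively. A pair $(\mathcal I,\mathcal J)$ of ideals of $\mathcal A$ is an ideal cotorsion pair if $\mathcal I=\{i \mid \mathrm{Ext}(i,j)=0\ \forall j\in\mathcal J\}$ and $\mathcal J=\{j\mid \mathrm{Ext}(i,j)=0\ \forall i\in\mathcal I\}$, where $\mathrm{Ext}(i,j)$ pulls a conflation back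 along $i$ and pushes it out along $j$. It is complete if every object $X$ has an $\mathrm{Ext}$-special $\mathcal I$-precover and an $\mathrm{Ext}$-special $\mathcal J$-preenvelope. Here an $\mathrm{Ext}$-special $\mathcal I$-precover of $X$ is a deflation $i\colon T\to X$ in $\mathcal I$ with a conflation $F\to T\xrightarrow{i}X$ that is the pushout of a conflation $K\to P\to X$, $P$ projective, along some $g\colon K\to F$ with $\mathrm{Ext}(i',g)=0$ for all $i'\in\mathcal I$; $\mathrm{Ext}$-special $\mathcal J$-preenvelopes are defined dually. A pair $(\mathcal U,\mathcal V)$ of ideals of $\underline{\mathcal A}$ is an ideal torsion pair if $\mathcal U=\{u\mid \mathrm{Hom}(u,v)=0\ \forall v\in\mathcal V\}$ and $\mathcal V=\{v\mid\mathrm{Hom}(u,v)=0\ \forall u\in\mathcal U\}$, where $\mathrm{Hom}(u,v)$ is the map $x\mapsto vxu$. It is complete if every object $X$ of $\underline{\mathcal A}$ has a $\mathcal U$-precover $T\to X$ (a morphism in $\mathcal U$ through which every morphism $T'\to X$ in $\mathcal U$ factors) that is the first morphism of some distinguished triangle $T\to X\to Z\to\Sigma(T)$, and, dually, a $\mathcal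 V$-preenvelope $X\to F$ that is the second morphism of some distinguished triangle $Z\to X\to F\to\Sigma(Z)$. The distinguished triangles are those isomorphic to some $\pi(A)\xrightarrow{\pi(f)}\pi(B)\to\pi(D)\to\pi(\Sigma(A))$, where $B\to D\to\Sigma(A)$ is the pushout of $A\to E_A\to\Sigma(A)$ along a morphism $f\colon A\to B$ of $\mathcal A$. Then $(\mathcal I,\mathcal J)\mapsto(\pi(\mathcal I),\pi(\Sigma(\mathcal J)))$ is a bijection from the ideal cotorsion pairs in $(\mathcal A;\mathcal E)$ onto the ideal torsion pairs in $\underline{\mathcal A}$, and an ideal cotorsion pair $(\mathcal I,\mathcal J)$ is complete if and only if the corresponding ideal torsion pair $(\pi(\mathcal I),\pi(\Sigma(\mathcal J)))$ is complete. -/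

import Mathlib

open CategoryTheory CategoryTheory.Limits

universe v u v' u'

/-! ### Ideals of preadditive categories -/

section Ideals

/-- An ideal of a preadditive category: an additive subbifunctor of `Hom`. -/
@[ext]
structure MorIdeal (C : Type u) [Category.{v} C] [Preadditive C] where
  hom : ∀ X Y : C, AddSubgroup (X ⟶ Y)
  comp_mem : ∀ {X A B Y : C} (f : X ⟶ A) {x : A ⟶ B} (g : B ⟶ Y),
    x ∈ hom A B → f ≫ x ≫ g ∈ hom X Y

namespace MorIdeal

variable {C : Type u} [Category.{v} C] [Preadditive C]
variable {D : Type u'} [Category.{v'} D] [Preadditive D]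

/-- The image of an ideal under an additive functor that is full and dense: the isomorphism
closure of the class of all `F(j)`, `j ∈ I`. It is an ideal of the target category. -/
def image (F : C ⥤ D) [F.Additive] [F.Full] [F.EssSurj] (I : MorIdeal C) : MorIdeal D where
  hom X Y :=
    { carrier := {h | ∃ (A B : C) (a : X ≅ F.obj A) (b : F.obj B ≅ Y) (j : A ⟶ B),
        j ∈ I.hom A B ∧ h = a.hom ≫ F.map j ≫ b.hom}
      zero_mem' := ⟨F.objPreimage X, F.objPreimage Y, (F.objObjPreimageIso X).symm,
        F.objObjPreimageIso Y, 0, (I.hom _ _).zero_mem, by simp⟩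
      add_mem' := by
        rintro _ _ ⟨A, B, a, b, j, hj, rfl⟩ ⟨A', B', a', b', j', hj', rfl⟩
        obtain ⟨s, hs⟩ := F.map_surjective (a.inv ≫ a'.hom)
        obtain ⟨t, ht⟩ := F.map_surjective (b'.hom ≫ b.inv)
        refine ⟨A, B, a, b, j + s ≫ j' ≫ t, (I.hom _ _).add_mem hj (I.comp_mem s t hj'), ?_⟩
        simp [Functor.map_add, hs, ht]
      neg_mem' := by
        rintro _ ⟨A, B, a, b, j, hj, rfl⟩
        exact ⟨A, B, a, b, -j, (I.hom _ _).neg_mem hj, by simp [Functor.map_neg]⟩ }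
  comp_mem := by
    rintro X X' Y' Y f _ g ⟨A, B, a, b, j, hj, rfl⟩
    obtain ⟨s, hs⟩ := F.map_surjective ((F.objObjPreimageIso X).hom ≫ f ≫ a.hom)
    obtain ⟨t, ht⟩ := F.map_surjective (b.hom ≫ g ≫ (F.objObjPreimageIso Y).inv)
    refine ⟨F.objPreimage X, F.objPreimage Y, (F.objObjPreimageIso X).symm,
      F.objObjPreimageIso Y, s ≫ j ≫ t, I.comp_mem s t hj, ?_⟩
    simp [hs, ht]

/-- `Hom(f, g) = 0`. -/
def HomOrthogonal {X A B Y : C} (f : X ⟶ A) (g : B ⟶ Y) : Prop :=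
  ∀ x : A ⟶ B, f ≫ x ≫ g = 0

/-- `(I, J)` is an ideal torsion pair: `I = ⊥J` and `J = I⊥` with respect to `Hom`. -/
def IsTorsionPair (I J : MorIdeal C) : Prop :=
  (∀ ⦃X A : C⦄ (i : X ⟶ A), i ∈ I.hom X A ↔
    ∀ ⦃B Y : C⦄ (j : B ⟶ Y), j ∈ J.hom B Y → HomOrthogonal i j) ∧
  (∀ ⦃B Y : C⦄ (j : B ⟶ Y), j ∈ J.hom B Y ↔
    ∀ ⦃X A : C⦄ (i : X ⟶ A), i ∈ I.hom X A → HomOrthogonal i j)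

/-- `i : T ⟶ X` is an `I`-precover of `X`. -/
def IsPrecover (I : MorIdeal C) {T X : C} (i : T ⟶ X) : Prop :=
  i ∈ I.hom T X ∧ ∀ ⦃T' : C⦄ (i' : T' ⟶ X), i' ∈ I.hom T' X → ∃ t : T' ⟶ T, t ≫ i = i'

/-- `j : X ⟶ F` is a `J`-preenvelope of `X`. -/
def IsPreenvelope (J : MorIdeal C) {X F : C} (j : X ⟶ F) : Prop :=
  j ∈ J.hom X F ∧ ∀ ⦃F' : C⦄ (j' : X ⟶ F'), j' ∈ J.hom X F' → ∃ t : F ⟶ F', j ≫ t = j'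

/-- Every object has an `I`-precover that is a weak inflation, where `W` is the collection of
weak conflations. -/
def HomSpecialPrecovering (W : ∀ ⦃X Y Z : C⦄, (X ⟶ Y) → (Y ⟶ Z) → Prop) (I : MorIdeal C) : Prop :=
  ∀ X : C, ∃ (T : C) (i : T ⟶ X), I.IsPrecover i ∧ ∃ (Z : C) (c : X ⟶ Z), W i c

/-- Every object has a `J`-preenvelope that is a weak deflation, where `W` is the collection of
weak conflations. -/
def HomSpecialPreenveloping (W : ∀ ⦃X Y Z : C⦄, (X ⟶ Y) → (Y ⟶ Z) → Prop) (J : MorIdeal C) :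
    Prop :=
  ∀ X : C, ∃ (F : C) (j : X ⟶ F), J.IsPreenvelope j ∧ ∃ (Z : C) (k : Z ⟶ X), W k j

/-- `(I, J)` is a complete ideal torsion pair with respect to the weak conflations `W`. -/
structure IsCompleteTorsionPair (W : ∀ ⦃X Y Z : C⦄, (X ⟶ Y) → (Y ⟶ Z) → Prop)
    (I J : MorIdeal C) : Prop where
  torsionPair : IsTorsionPair I J
  precovering : HomSpecialPrecovering W I
  preenveloping : HomSpecialPreenveloping W J

end MorIdeal

end Ideals

/-! ### Exact categories -/

section Exact

/-- A (Quillen) exact structure on an additive category: a class of kernel-cokernel pairs, closed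
under isomorphism, such that identities are inflations and deflations, inflations (deflations) are
closed under composition, and pushouts of inflations (pullbacks of deflations) along arbitrary
morphisms exist and are inflations (deflations). -/
structure ExactStructure (C : Type u) [Category.{v} C] [Preadditive C]
    [HasFiniteBiproducts C] where
  conflation : ShortComplex C → Prop
  of_iso : ∀ {S S' : ShortComplex C}, (S ≅ S') → conflation S → conflation S'
  kernel : ∀ {S : ShortComplex C}, conflation S → Nonempty (IsLimit (KernelFork.ofι S.f S.zero))
  cokernel : ∀ {S : ShortComplex C}, conflation S →
    Nonempty (IsColimit (CokernelCofork.ofπ S.g S.zero))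
  id_inflation : ∀ A : C,
    ∃ (Z : C) (c : A ⟶ Z) (w : 𝟙 A ≫ c = 0), conflation (.mk (𝟙 A) c w)
  id_deflation : ∀ A : C,
    ∃ (Z : C) (k : Z ⟶ A) (w : k ≫ 𝟙 A = 0), conflation (.mk k (𝟙 A) w)
  comp_inflation : ∀ {A B D : C} (f : A ⟶ B) (g : B ⟶ D),
    (∃ (Z : C) (c : B ⟶ Z) (w : f ≫ c = 0), conflation (.mk f c w)) →
    (∃ (Z : C) (c : D ⟶ Z) (w : g ≫ c = 0), conflation (.mk g c w)) →
    ∃ (Z : C) (c : D ⟶ Z) (w : (f ≫ g) ≫ c = 0), conflation (.mk (f ≫ g) c w)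
  comp_deflation : ∀ {A B D : C} (f : A ⟶ B) (g : B ⟶ D),
    (∃ (Z : C) (k : Z ⟶ A) (w : k ≫ f = 0), conflation (.mk k f w)) →
    (∃ (Z : C) (k : Z ⟶ B) (w : k ≫ g = 0), conflation (.mk k g w)) →
    ∃ (Z : C) (k : Z ⟶ A) (w : k ≫ f ≫ g = 0), conflation (.mk k (f ≫ g) w)
  pushout_inflation : ∀ {A B A' : C} (i : A ⟶ B) (f : A ⟶ A'),
    (∃ (Z : C) (c : B ⟶ Z) (w : i ≫ c = 0), conflation (.mk i c w)) →
    ∃ (B' : C) (f' : B ⟶ B') (i' : A' ⟶ B'), IsPushout i f f' i' ∧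
      ∃ (Z : C) (c : B' ⟶ Z) (w : i' ≫ c = 0), conflation (.mk i' c w)
  pullback_deflation : ∀ {B D D' : C} (p : B ⟶ D) (f : D' ⟶ D),
    (∃ (Z : C) (k : Z ⟶ B) (w : k ≫ p = 0), conflation (.mk k p w)) →
    ∃ (B' : C) (f' : B' ⟶ B) (p' : B' ⟶ D'), IsPullback f' p' p f ∧
      ∃ (Z : C) (k : Z ⟶ B') (w : k ≫ p' = 0), conflation (.mk k p' w)

namespace ExactStructure

variable {C : Type u} [Category.{v} C] [Preadditive C] [HasFiniteBiproducts C]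
variable (E : ExactStructure C)

/-- `(k, c)` is a conflation. -/
def Conf {A B D : C} (k : A ⟶ B) (c : B ⟶ D) : Prop :=
  ∃ w : k ≫ c = 0, E.conflation (.mk k c w)

/-- `k` is an inflation. -/
def Inflation {A B : C} (k : A ⟶ B) : Prop := ∃ (D : C) (c : B ⟶ D), E.Conf k c

/-- `c` is a deflation. -/
def Deflation {B D : C} (c : B ⟶ D) : Prop := ∃ (A : C) (k : A ⟶ B), E.Conf k c

/-- `P` is a projective object of the exact category. -/
def Proj (P : C) : Prop :=
  ∀ ⦃B D : C⦄ (c : B ⟶ D), E.Deflation c → ∀ f : P ⟶ D, ∃ g : P ⟶ B, g ≫ c = f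

/-- `Q` is an injective object of the exact category. -/
def Inj (Q : C) : Prop :=
  ∀ ⦃A B : C⦄ (k : A ⟶ B), E.Inflation k → ∀ f : A ⟶ Q, ∃ g : B ⟶ Q, k ≫ g = f

/-- The exact category is Frobenius. -/
class IsFrobenius : Prop where
  enough_proj : ∀ A : C, ∃ (P : C) (p : P ⟶ A), E.Proj P ∧ E.Deflation p
  enough_inj : ∀ A : C, ∃ (Q : C) (q : A ⟶ Q), E.Inj Q ∧ E.Inflation q
  proj_iff_inj : ∀ P : C, E.Proj P ↔ E.Inj P

/-- `Ext(f, g) = 0`: for every conflation `B ⟶ M ⟶ A`, its pullback `B ⟶ M' ⟶ X` along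
`f : X ⟶ A`, followed by the pushout `Y ⟶ M'' ⟶ X` along `g : B ⟶ Y`, is a split conflation. -/
def ExtOrthogonal {X A B Y : C} (f : X ⟶ A) (g : B ⟶ Y) : Prop :=
  ∀ ⦃M M' M'' : C⦄ (k : B ⟶ M) (c : M ⟶ A) (k' : B ⟶ M') (c' : M' ⟶ X)
    (k'' : Y ⟶ M'') (c'' : M'' ⟶ X) (m : M' ⟶ M) (n : M' ⟶ M''),
    E.Conf k c → E.Conf k' c' → E.Conf k'' c'' →
    IsPullback m c' c f → k' ≫ m = k →
    IsPushout k' g n k'' → n ≫ c'' = c' →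
    ∃ s : X ⟶ M'', s ≫ c'' = 𝟙 X

/-- `(I, J)` is an ideal cotorsion pair: `I = ⊥J` and `J = I⊥` with respect to `Ext`. -/
def IsCotorsionPair (I J : MorIdeal C) : Prop :=
  (∀ ⦃X A : C⦄ (i : X ⟶ A), i ∈ I.hom X A ↔
    ∀ ⦃B Y : C⦄ (j : B ⟶ Y), j ∈ J.hom B Y → E.ExtOrthogonal i j) ∧
  (∀ ⦃B Y : C⦄ (j : B ⟶ Y), j ∈ J.hom B Y ↔
    ∀ ⦃X A : C⦄ (i : X ⟶ A), i ∈ I.hom X A → E.ExtOrthogonal i j)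

/-- `i : T ⟶ X` is an `Ext`-special `I`-precover: it lies in `I` and there is a commutative
diagram of conflations from `K ⟶ P ⟶ X` (`P` projective) to `F ⟶ T ⟶ X`, the identity on `X`
and on kernels a morphism `g : K ⟶ F` with `Ext(I, g) = 0`. -/
def IsExtSpecialPrecover (I : MorIdeal C) {T X : C} (i : T ⟶ X) : Prop :=
  i ∈ I.hom T X ∧ ∃ (K P F : C) (k : K ⟶ P) (p : P ⟶ X) (l : F ⟶ T) (g : K ⟶ F) (h : P ⟶ T),
    E.Proj P ∧ E.Conf k p ∧ E.Conf l i ∧ g ≫ l = k ≫ h ∧ h ≫ i = p ∧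
    ∀ ⦃X' A' : C⦄ (i' : X' ⟶ A'), i' ∈ I.hom X' A' → E.ExtOrthogonal i' g

/-- `j : X ⟶ F` is an `Ext`-special `J`-preenvelope: it lies in `J` and there is a commutative
diagram of conflations from `X ⟶ F ⟶ T` to `X ⟶ Q ⟶ K` (`Q` injective), the identity on `X`
and on cokernels a morphism `g : T ⟶ K` with `Ext(g, J) = 0`. -/
def IsExtSpecialPreenvelope (J : MorIdeal C) {X F : C} (j : X ⟶ F) : Prop :=
  j ∈ J.hom X F ∧ ∃ (T Q K : C) (q : X ⟶ Q) (c : Q ⟶ K) (d : F ⟶ T) (g : T ⟶ K) (h : F ⟶ Q),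
    E.Inj Q ∧ E.Conf q c ∧ E.Conf j d ∧ d ≫ g = h ≫ c ∧ j ≫ h = q ∧
    ∀ ⦃B' Y' : C⦄ (j' : B' ⟶ Y'), j' ∈ J.hom B' Y' → E.ExtOrthogonal g j'

/-- `(I, J)` is a complete ideal cotorsion pair. -/
structure IsCompleteCotorsionPair (I J : MorIdeal C) : Prop where
  cotorsionPair : E.IsCotorsionPair I J
  precovering : ∀ X : C, ∃ (T : C) (i : T ⟶ X), E.IsExtSpecialPrecover I i
  preenveloping : ∀ X : C, ∃ (F : C) (j : X ⟶ F), E.IsExtSpecialPreenvelope J j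

/-! ### The stable category -/

/-- `f` factors through a projective object. -/
def FactorsProj {A B : C} (f : A ⟶ B) : Prop :=
  ∃ (P : C) (a : A ⟶ P) (b : P ⟶ B), E.Proj P ∧ a ≫ b = f

/-- The relation whose quotient is the stable category. -/
def stableRel : HomRel C := fun _ _ f g => E.FactorsProj (f - g)

variable {E}

theorem Proj.biprod {P Q : C} [HasBinaryBiproduct P Q] (hP : E.Proj P) (hQ : E.Proj Q) :
    E.Proj (P ⊞ Q) := by
  intro B D c hc f
  obtain ⟨g, hg⟩ := hP c hc (biprod.inl ≫ f)
  obtain ⟨h, hh⟩ := hQ c hc (biprod.inr ≫ f)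
  exact ⟨biprod.desc g h, by ext <;> simp [hg, hh]⟩

theorem FactorsProj.add {A B : C} {f g : A ⟶ B} (hf : E.FactorsProj f) (hg : E.FactorsProj g) :
    E.FactorsProj (f + g) := by
  obtain ⟨P, a, b, hP, rfl⟩ := hf
  obtain ⟨Q, a', b', hQ, rfl⟩ := hg
  have : HasBinaryBiproducts C := hasBinaryBiproducts_of_finite_biproducts C
  exact ⟨P ⊞ Q, biprod.lift a a', biprod.desc b b', hP.biprod hQ, by simp⟩

theorem FactorsProj.neg {A B : C} {f : A ⟶ B} (hf : E.FactorsProj f) : E.FactorsProj (-f) := by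
  obtain ⟨P, a, b, hP, rfl⟩ := hf
  exact ⟨P, -a, b, hP, by simp⟩

theorem FactorsProj.comp {X A B Y : C} (s : X ⟶ A) {f : A ⟶ B} (hf : E.FactorsProj f)
    (t : B ⟶ Y) : E.FactorsProj (s ≫ f ≫ t) := by
  obtain ⟨P, a, b, hP, rfl⟩ := hf
  exact ⟨P, s ≫ a, b ≫ t, hP, by simp⟩

theorem proj_zero_factors {A B : C} : E.FactorsProj (0 : A ⟶ B) := by
  have : HasZeroObject C := hasZeroObject_of_hasFiniteBiproducts C
  obtain ⟨Z, hZ⟩ := HasZeroObject.zero (C := C)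
  exact ⟨Z, 0, 0, fun _ _ _ _ f => ⟨0, hZ.eq_of_src _ _⟩, by simp⟩

variable (E)

instance : Congruence E.stableRel where
  equivalence :=
    { refl := fun f => by simpa [stableRel] using proj_zero_factors
      symm := fun h => by simpa [stableRel] using FactorsProj.neg h
      trans := fun h h' => by simpa [stableRel] using FactorsProj.add h h' }
  comp_left f g g' h := by
    simpa [stableRel, Preadditive.comp_sub] using FactorsProj.comp f h (𝟙 _)
  comp_right g h := by
    simpa [stableRel, Preadditive.sub_comp] using FactorsProj.comp (𝟙 _) h g

/-- The stable category: the quotient of `C` by the morphisms that factor through a projective. -/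
abbrev Stable := CategoryTheory.Quotient E.stableRel

theorem stableRel_add ⦃X Y : C⦄ (f₁ f₂ g₁ g₂ : X ⟶ Y) (hf : E.stableRel f₁ f₂)
    (hg : E.stableRel g₁ g₂) : E.stableRel (f₁ + g₁) (f₂ + g₂) := by
  have h := FactorsProj.add hf hg
  rwa [show f₁ - f₂ + (g₁ - g₂) = f₁ + g₁ - (f₂ + g₂) by abel] at h

instance : Preadditive E.Stable := Quotient.preadditive _ E.stableRel_add

/-- The stable quotient functor. -/
abbrev stab : C ⥤ E.Stable := Quotient.functor E.stableRel

instance : E.stab.Additive := Quotient.functor_additive _ E.stableRel_add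

theorem stab_map_eq_iff {A B : C} (f g : A ⟶ B) :
    E.stab.map f = E.stab.map g ↔ E.FactorsProj (f - g) :=
  Quotient.functor_map_eq_iff E.stableRel f g

/-! ### The cosyzygy functor -/

variable {E}

theorem Conf.lift {A B D : C} {k : A ⟶ B} {c : B ⟶ D} (h : E.Conf k c) {X : C} (x : X ⟶ B)
    (hx : x ≫ c = 0) : ∃ y : X ⟶ A, y ≫ k = x := by
  obtain ⟨w, hw⟩ := h
  obtain ⟨hl⟩ := E.kernel hw
  exact ⟨(KernelFork.IsLimit.lift' hl x hx).1, (KernelFork.IsLimit.lift' hl x hx).2⟩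

theorem Conf.desc {A B D : C} {k : A ⟶ B} {c : B ⟶ D} (h : E.Conf k c) {X : C} (x : B ⟶ X)
    (hx : k ≫ x = 0) : ∃ y : D ⟶ X, c ≫ y = x := by
  obtain ⟨w, hw⟩ := h
  obtain ⟨hl⟩ := E.cokernel hw
  exact ⟨(CokernelCofork.IsColimit.desc' hl x hx).1, (CokernelCofork.IsColimit.desc' hl x hx).2⟩

theorem Conf.epi {A B D : C} {k : A ⟶ B} {c : B ⟶ D} (h : E.Conf k c) : Epi c := by
  obtain ⟨w, hw⟩ := h
  obtain ⟨hl⟩ := E.cokernel hw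
  exact ⟨fun x y hxy => Cofork.IsColimit.hom_ext hl hxy⟩

/-- `(f, e, s)` is a morphism from `A ⟶ Q ⟶ S` to `A' ⟶ Q' ⟶ S'` for some `e`. -/
def IsCosyzygyMap {A Q S A' Q' S' : C} (k : A ⟶ Q) (c : Q ⟶ S) (k' : A' ⟶ Q') (c' : Q' ⟶ S')
    (f : A ⟶ A') (s : S ⟶ S') : Prop :=
  ∃ e : Q ⟶ Q', k ≫ e = f ≫ k' ∧ c ≫ s = e ≫ c'

theorem IsCosyzygyMap.comp {A Q S A' Q' S' A'' Q'' S'' : C} {k : A ⟶ Q} {c : Q ⟶ S}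
    {k' : A' ⟶ Q'} {c' : Q' ⟶ S'} {k'' : A'' ⟶ Q''} {c'' : Q'' ⟶ S''} {f : A ⟶ A'} {s : S ⟶ S'}
    {f' : A' ⟶ A''} {s' : S' ⟶ S''} (h : IsCosyzygyMap k c k' c' f s)
    (h' : IsCosyzygyMap k' c' k'' c'' f' s') :
    IsCosyzygyMap k c k'' c'' (f ≫ f') (s ≫ s') := by
  obtain ⟨e, he, hs⟩ := h
  obtain ⟨e', he', hs'⟩ := h'
  refine ⟨e ≫ e', ?_, ?_⟩
  · rw [← Category.assoc, he, Category.assoc, he', Category.assoc]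
  · rw [← Category.assoc, hs, Category.assoc, hs', Category.assoc]

theorem exists_cosyzygyMap {A Q S A' Q' S' : C} {k : A ⟶ Q} {c : Q ⟶ S} {k' : A' ⟶ Q'}
    {c' : Q' ⟶ S'} (h : E.Conf k c) (h' : E.Conf k' c') (hQ' : E.Inj Q') (f : A ⟶ A') :
    ∃ s : S ⟶ S', IsCosyzygyMap k c k' c' f s := by
  obtain ⟨e, he⟩ := hQ' k ⟨_, _, h⟩ (f ≫ k')
  have w' := h'.1
  obtain ⟨s, hs⟩ := h.desc (e ≫ c') (by rw [← Category.assoc, he, Category.assoc, w', comp_zero])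
  exact ⟨s, e, he, hs⟩

variable [E.IsFrobenius]

theorem exists_of_cosyzygy {A Q S A' Q' S' : C} {k : A ⟶ Q} {c : Q ⟶ S} {k' : A' ⟶ Q'}
    {c' : Q' ⟶ S'} (h : E.Conf k c) (h' : E.Conf k' c') (hQ : E.Inj Q) (s : S ⟶ S') :
    ∃ f : A ⟶ A', IsCosyzygyMap k c k' c' f s := by
  obtain ⟨e, he⟩ := (IsFrobenius.proj_iff_inj Q).2 hQ c' ⟨_, _, h'⟩ (c ≫ s)
  have w := h.1
  obtain ⟨f, hf⟩ := h'.lift (k ≫ e) (by rw [Category.assoc, he, ← Category.assoc, w, zero_comp])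
  exact ⟨f, e, hf.symm, he.symm⟩

theorem cosyzygyMap_unique {A Q S A' Q' S' : C} {k : A ⟶ Q} {c : Q ⟶ S} {k' : A' ⟶ Q'}
    {c' : Q' ⟶ S'} (h : E.Conf k c) (h' : E.Conf k' c') (hQ' : E.Inj Q') {f f' : A ⟶ A'}
    {s s' : S ⟶ S'} (hs : IsCosyzygyMap k c k' c' f s) (hs' : IsCosyzygyMap k c k' c' f' s')
    (hf : E.stab.map f = E.stab.map f') : E.stab.map s = E.stab.map s' := by
  rw [stab_map_eq_iff] at hf ⊢
  obtain ⟨P, a, b, hP, hab⟩ := hf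
  obtain ⟨e, he, hes⟩ := hs
  obtain ⟨e', he', hes'⟩ := hs'
  obtain ⟨a', ha'⟩ := (IsFrobenius.proj_iff_inj P).1 hP k ⟨_, _, h⟩ a
  obtain ⟨t, ht⟩ := h.desc (e - e' - a' ≫ b ≫ k') (by
    rw [Preadditive.comp_sub, Preadditive.comp_sub, he, he', ← Category.assoc k a', ha',
      ← Category.assoc a b, hab, Preadditive.sub_comp, sub_self])
  refine ⟨Q', t, c', (IsFrobenius.proj_iff_inj Q').2 hQ', ?_⟩
  have := h.epi
  have w' := h'.1
  rw [← cancel_epi c, ← Category.assoc, ht, Preadditive.comp_sub, hes, hes']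
  simp [Preadditive.sub_comp, w']

variable (E)

theorem exists_cosyzygy (A : C) :
    ∃ (Q S : C) (k : A ⟶ Q) (c : Q ⟶ S), E.Inj Q ∧ E.Conf k c := by
  obtain ⟨Q, q, hQ, S, c, h⟩ := IsFrobenius.enough_inj (E := E) A
  exact ⟨Q, S, q, c, hQ, h⟩

/-- The injective object in a fixed conflation `A ⟶ Q ⟶ Σ(A)`. -/
noncomputable def injHull (A : C) : C := (E.exists_cosyzygy A).choose

/-- The cosyzygy object `Σ(A)`. -/
noncomputable def cosyz (A : C) : C := (E.exists_cosyzygy A).choose_spec.choose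

/-- The inflation of the fixed conflation `A ⟶ Q ⟶ Σ(A)`. -/
noncomputable def cosyzι (A : C) : A ⟶ E.injHull A :=
  (E.exists_cosyzygy A).choose_spec.choose_spec.choose

/-- The deflation of the fixed conflation `A ⟶ Q ⟶ Σ(A)`. -/
noncomputable def cosyzπ (A : C) : E.injHull A ⟶ E.cosyz A :=
  (E.exists_cosyzygy A).choose_spec.choose_spec.choose_spec.choose

theorem injHull_inj (A : C) : E.Inj (E.injHull A) :=
  (E.exists_cosyzygy A).choose_spec.choose_spec.choose_spec.choose_spec.1

theorem cosyz_conf (A : C) : E.Conf (E.cosyzι A) (E.cosyzπ A) :=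
  (E.exists_cosyzygy A).choose_spec.choose_spec.choose_spec.choose_spec.2

/-- `s` is a cosyzygy morphism `Σ(f)` of `f`. -/
def IsSigma {A B : C} (f : A ⟶ B) (s : E.cosyz A ⟶ E.cosyz B) : Prop :=
  IsCosyzygyMap (E.cosyzι A) (E.cosyzπ A) (E.cosyzι B) (E.cosyzπ B) f s

theorem exists_isSigma {A B : C} (f : A ⟶ B) : ∃ s, E.IsSigma f s :=
  exists_cosyzygyMap (E.cosyz_conf A) (E.cosyz_conf B) (E.injHull_inj B) f

variable {E}

theorem IsSigma.unique {A B : C} {f f' : A ⟶ B} {s s' : E.cosyz A ⟶ E.cosyz B}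
    (hs : E.IsSigma f s) (hs' : E.IsSigma f' s') (hf : E.stab.map f = E.stab.map f') :
    E.stab.map s = E.stab.map s' :=
  cosyzygyMap_unique (E.cosyz_conf A) (E.cosyz_conf B) (E.injHull_inj B) hs hs' hf

variable (E)

/-- The functor `Σ` from `C` to the stable category, `A ↦ π(Σ(A))`, `f ↦ π(Σ(f))`. -/
noncomputable def sigma : C ⥤ E.Stable where
  obj A := E.stab.obj (E.cosyz A)
  map f := E.stab.map (E.exists_isSigma f).choose
  map_id A := by
    rw [← E.stab.map_id]
    exact (E.exists_isSigma (𝟙 A)).choose_spec.unique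
      (show E.IsSigma (𝟙 A) (𝟙 _) from ⟨𝟙 _, by simp, by simp⟩) rfl
  map_comp f g := by
    rw [← E.stab.map_comp]
    exact (E.exists_isSigma (f ≫ g)).choose_spec.unique
      ((E.exists_isSigma f).choose_spec.comp (E.exists_isSigma g).choose_spec) rfl

theorem sigma_map {A B : C} {f : A ⟶ B} {s : E.cosyz A ⟶ E.cosyz B} (h : E.IsSigma f s) :
    E.sigma.map f = E.stab.map s :=
  (E.exists_isSigma f).choose_spec.unique h rfl

instance : E.sigma.Additive where
  map_add {A B f g} := by
    obtain ⟨s, hs⟩ := E.exists_isSigma f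
    obtain ⟨t, ht⟩ := E.exists_isSigma g
    rw [E.sigma_map hs, E.sigma_map ht]
    obtain ⟨e, he, hes⟩ := hs
    obtain ⟨e', he', het⟩ := ht
    exact (E.sigma_map (s := s + t) ⟨e + e', by simp [he, he'], by simp [hes, het]⟩).trans
      E.stab.map_add

instance : E.sigma.Full where
  map_surjective {A B} g := by
    obtain ⟨s, rfl⟩ := E.stab.map_surjective g
    obtain ⟨f, hf⟩ := exists_of_cosyzygy (E.cosyz_conf A) (E.cosyz_conf B) (E.injHull_inj A) s
    exact ⟨f, E.sigma_map hf⟩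

instance : E.sigma.EssSurj where
  mem_essImage X := by
    obtain ⟨P, p, hP, K, k, h⟩ := IsFrobenius.enough_proj (E := E) X.as
    have hP' := (IsFrobenius.proj_iff_inj (E := E) P).1 hP
    obtain ⟨s, hs⟩ := exists_cosyzygyMap (E.cosyz_conf K) h hP' (𝟙 K)
    obtain ⟨t, ht⟩ := exists_cosyzygyMap h (E.cosyz_conf K) (E.injHull_inj K) (𝟙 K)
    refine ⟨K, ⟨⟨E.stab.map s, E.stab.map t, ?_, ?_⟩⟩⟩
    · refine (E.stab.map_comp s t).symm.trans (Eq.trans ?_ (E.stab.map_id _))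
      exact cosyzygyMap_unique (E.cosyz_conf K) (E.cosyz_conf K) (E.injHull_inj K)
        (hs.comp ht) (f' := 𝟙 K) ⟨𝟙 _, by simp, by simp⟩ (by simp)
    · refine (E.stab.map_comp t s).symm.trans (Eq.trans ?_ (E.stab.map_id _))
      exact cosyzygyMap_unique h h hP' (ht.comp hs) (f' := 𝟙 K) ⟨𝟙 _, by simp, by simp⟩ (by simp)

/-- The shift endofunctor of the stable category induced by `Σ`. -/
noncomputable def stableShift : E.Stable ⥤ E.Stable :=
  CategoryTheory.Quotient.lift E.stableRel E.sigma (fun _ _ f g h => by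
    obtain ⟨s, hs⟩ := E.exists_isSigma f
    obtain ⟨t, ht⟩ := E.exists_isSigma g
    rw [E.sigma_map hs, E.sigma_map ht]
    exact hs.unique ht ((E.stab_map_eq_iff f g).2 h))

/-- A distinguished triangle `X ⟶ Y ⟶ Z ⟶ Σ(X)` of the stable category: one that is isomorphic to
a standard triangle `π(A) ⟶ π(B) ⟶ π(D) ⟶ π(Σ(A))`, where `A ⟶ B` is a morphism `f` of `C` and
`B ⟶ D ⟶ Σ(A)` is the pushout along `f` of the fixed conflation `A ⟶ Q ⟶ Σ(A)`. -/
def IsTriangle {X Y Z : E.Stable} (x : X ⟶ Y) (y : Y ⟶ Z) (z : Z ⟶ E.stableShift.obj X) : Prop :=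
  ∃ (A B D : C) (f : A ⟶ B) (g : B ⟶ D) (q : E.injHull A ⟶ D) (w : D ⟶ E.cosyz A)
    (a : X ≅ E.stab.obj A) (b : Y ≅ E.stab.obj B) (d : Z ≅ E.stab.obj D),
    IsPushout (E.cosyzι A) f q g ∧ q ≫ w = E.cosyzπ A ∧ g ≫ w = 0 ∧
    x ≫ b.hom = a.hom ≫ E.stab.map f ∧ y ≫ d.hom = b.hom ≫ E.stab.map g ∧
    z ≫ E.stableShift.map a.hom = d.hom ≫ E.stab.map w

/-- The weak conflations of the stable category: the pairs of consecutive morphisms that start a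
distinguished triangle. -/
def StableWeakConf ⦃X Y Z : E.Stable⦄ (x : X ⟶ Y) (y : Y ⟶ Z) : Prop :=
  ∃ z : Z ⟶ E.stableShift.obj X, E.IsTriangle x y z

end ExactStructure

end Exact

/-! ### Images and inverse images of ideals under full and dense functors -/

namespace MorIdeal

variable {C : Type u} [Category.{v} C] [Preadditive C]
variable {D : Type u'} [Category.{v'} D] [Preadditive D]

/-! Conflations `B ⟶ M ⟶ A` are controlled by their connecting morphisms `A ⟶ Σ(B)` in the stable
category. A conflation splits iff this morphism vanishes (`Conf.section_iff`); pullback along `f`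
precomposes it with `π(f)`, and pushout along `g` composes it with `Σ(g)`. Every stable morphism `A
⟶ Σ(B)` arises in this way, so `Ext(f, g) = 0` iff `Hom(π(f), Σ(g)) = 0` (`extOrthogonal_iff`).

Hence the two ideals of a cotorsion pair depend only on the images of morphisms under `π` and `Σ`.
Since both functors are full and dense, taking images and taking inverse images are mutually inverse
and match the two kinds of orthogonality.

For completeness, the triangles cost nothing: every stable morphism is the first morphism of some
triangle and the second of another. What remains is to compare special approximations with stable
ones. The lifting criterion `Conf.lift_iff` and its dual `Conf.extend_iff` show that special
approximations are approximations. Conversely, a stable approximation becomes a deflation or an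
inflation after adding a projective or injective summand, and its factorization property makes it
special. -/

theorem comp_left_mem (I : MorIdeal C) {X A B : C} (f : X ⟶ A) {x : A ⟶ B}
    (hx : x ∈ I.hom A B) : f ≫ x ∈ I.hom X B := by
  simpa using I.comp_mem f (𝟙 _) hx

theorem comp_right_mem (I : MorIdeal C) {A B Y : C} {x : A ⟶ B} (g : B ⟶ Y)
    (hx : x ∈ I.hom A B) : x ≫ g ∈ I.hom A Y := by
  simpa using I.comp_mem (𝟙 _) g hx

/-- The inverse image of an ideal under an additive functor. -/
def comap (F : C ⥤ D) [F.Additive] (U : MorIdeal D) : MorIdeal C where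
  hom X Y := (U.hom (F.obj X) (F.obj Y)).comap (F.mapAddHom)
  comp_mem f x g hx := by
    simpa using U.comp_mem (F.map f) (F.map g) hx

theorem mem_comap (F : C ⥤ D) [F.Additive] (U : MorIdeal D) {X Y : C} (f : X ⟶ Y) :
    f ∈ (U.comap F).hom X Y ↔ F.map f ∈ U.hom _ _ := Iff.rfl

section Image

variable (F : C ⥤ D) [F.Additive] [F.Full] [F.EssSurj]

theorem map_mem_image {I : MorIdeal C} {A B : C} {f : A ⟶ B} (hf : f ∈ I.hom A B) :
    F.map f ∈ (I.image F).hom _ _ :=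
  ⟨A, B, Iso.refl _, Iso.refl _, f, hf, by simp⟩

/-- By fullness the isomorphisms of the witness lift to morphisms of the source category, and the
ideal absorbs them. The lifts need not be isomorphisms. -/
theorem exists_of_map_mem_image {I : MorIdeal C} {A B : C} {f : A ⟶ B}
    (hf : F.map f ∈ (I.image F).hom _ _) : ∃ g ∈ I.hom A B, F.map f = F.map g := by
  obtain ⟨A', B', a, b, j, hj, h⟩ := hf
  obtain ⟨s, hs⟩ := F.map_surjective a.hom
  obtain ⟨t, ht⟩ := F.map_surjective b.hom
  exact ⟨s ≫ j ≫ t, I.comp_mem s t hj, by simp [h, hs, ht]⟩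

theorem image_comap (U : MorIdeal D) : (U.comap F).image F = U := by
  ext X Y f
  constructor
  · rintro ⟨A, B, a, b, j, hj, rfl⟩
    exact U.comp_mem _ _ hj
  · intro hf
    obtain ⟨s, hs⟩ := F.map_surjective
      ((F.objObjPreimageIso X).hom ≫ f ≫ (F.objObjPreimageIso Y).inv)
    refine ⟨_, _, (F.objObjPreimageIso X).symm, F.objObjPreimageIso Y, s, ?_, by simp [hs]⟩
    rw [mem_comap, hs]
    exact U.comp_mem _ _ hf

/-- Only saturated ideals are recovered from their images. Ideals defined by orthogonality after
applying `F` are saturated. -/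
theorem comap_image {I : MorIdeal C}
    (hI : ∀ ⦃A B : C⦄ (f g : A ⟶ B), F.map f = F.map g → g ∈ I.hom A B → f ∈ I.hom A B) :
    (I.image F).comap F = I := by
  ext A B f
  refine ⟨fun hf => ?_, fun hf => map_mem_image F hf⟩
  obtain ⟨g, hg, h⟩ := exists_of_map_mem_image F hf
  exact hI f g h hg

end Image

theorem HomOrthogonal.comp {X' X A A' B' B Y Y' : C} {f : X ⟶ A} {g : B ⟶ Y}
    (h : HomOrthogonal f g) (a : X' ⟶ X) (b : A ⟶ A') (c : B' ⟶ B) (d : Y ⟶ Y') :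
    HomOrthogonal (a ≫ f ≫ b) (c ≫ g ≫ d) := by
  intro x
  have := h (b ≫ x ≫ c)
  calc _ = a ≫ (f ≫ (b ≫ x ≫ c) ≫ g) ≫ d := by simp
    _ = 0 := by rw [this]; simp

theorem comap_homOrthogonal_left {F G : C ⥤ D} [G.Additive] [G.Full] [G.EssSurj]
    {V : MorIdeal D} {X A : C} (i : X ⟶ A) :
    (∀ ⦃B Y : D⦄ (v : B ⟶ Y), v ∈ V.hom B Y → HomOrthogonal (F.map i) v) ↔
      ∀ ⦃B Y : C⦄ (j : B ⟶ Y), j ∈ (V.comap G).hom B Y → HomOrthogonal (F.map i) (G.map j) := by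
  refine ⟨fun h B Y j hj => h _ hj, fun h B Y v hv => ?_⟩
  rw [← image_comap G V] at hv
  obtain ⟨A, B, a, b, j, hj, rfl⟩ := hv
  simpa using (h j hj).comp (𝟙 _) (𝟙 _) a.hom b.hom

theorem comap_homOrthogonal_right {F G : C ⥤ D} [F.Additive] [F.Full] [F.EssSurj]
    {U : MorIdeal D} {B Y : C} (j : B ⟶ Y) :
    (∀ ⦃X A : D⦄ (u : X ⟶ A), u ∈ U.hom X A → HomOrthogonal u (G.map j)) ↔
      ∀ ⦃X A : C⦄ (i : X ⟶ A), i ∈ (U.comap F).hom X A → HomOrthogonal (F.map i) (G.map j) := by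
  refine ⟨fun h X A i hi => h _ hi, fun h X A u hu => ?_⟩
  rw [← image_comap F U] at hu
  obtain ⟨A, B, a, b, i, hi, rfl⟩ := hu
  simpa using (h i hi).comp a.hom b.hom (𝟙 _) (𝟙 _)

/-- A pair of ideals is a torsion pair if and only if its inverse images under two full and dense
functors are orthogonal complements of each other. -/
theorem isTorsionPair_iff_comap (F G : C ⥤ D) [F.Additive] [F.Full] [F.EssSurj]
    [G.Additive] [G.Full] [G.EssSurj] (U V : MorIdeal D) :
    IsTorsionPair U V ↔
    (∀ ⦃X A : C⦄ (i : X ⟶ A), i ∈ (U.comap F).hom X A ↔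
      ∀ ⦃B Y : C⦄ (j : B ⟶ Y), j ∈ (V.comap G).hom B Y → HomOrthogonal (F.map i) (G.map j)) ∧
    (∀ ⦃B Y : C⦄ (j : B ⟶ Y), j ∈ (V.comap G).hom B Y ↔
      ∀ ⦃X A : C⦄ (i : X ⟶ A), i ∈ (U.comap F).hom X A →
        HomOrthogonal (F.map i) (G.map j)) := by
  constructor
  · rintro ⟨hU, hV⟩
    exact ⟨fun X A i => (hU _).trans (comap_homOrthogonal_left i),
      fun B Y j => (hV _).trans (comap_homOrthogonal_right j)⟩
  · rintro ⟨hU, hV⟩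
    constructor
    · intro X A u
      refine ⟨fun hu B Y v hv => ?_, fun h => ?_⟩
      · rw [← image_comap F U] at hu
        obtain ⟨A', B', a, b, i, hi, rfl⟩ := hu
        simpa using ((comap_homOrthogonal_left i).2 ((hU i).1 hi) v hv).comp a.hom b.hom (𝟙 _) (𝟙 _)
      -- Density and fullness replace `u` by a conjugate of the form `F.map i`, where the criterion
      -- in `C` applies; the isomorphisms carry the result back.
      · obtain ⟨i, hi⟩ := F.map_surjective
          ((F.objObjPreimageIso X).hom ≫ u ≫ (F.objObjPreimageIso A).inv)
        have hiU : F.map i ∈ U.hom _ _ := (hU i).2 fun B Y j hj => by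
          rw [hi]
          simpa using (h _ hj).comp (F.objObjPreimageIso X).hom (F.objObjPreimageIso A).inv
            (𝟙 _) (𝟙 _)
        simpa [hi] using U.comp_mem (F.objObjPreimageIso X).inv (F.objObjPreimageIso A).hom hiU
    · intro B Y v
      refine ⟨fun hv X A u hu => ?_, fun h => ?_⟩
      · rw [← image_comap G V] at hv
        obtain ⟨A', B', a, b, j, hj, rfl⟩ := hv
        simpa using ((comap_homOrthogonal_right j).2 ((hV j).1 hj) u hu).comp (𝟙 _) (𝟙 _)
          a.hom b.hom
      · obtain ⟨j, hj⟩ := G.map_surjective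
          ((G.objObjPreimageIso B).hom ≫ v ≫ (G.objObjPreimageIso Y).inv)
        have hjV : G.map j ∈ V.hom _ _ := (hV j).2 fun X A i hi => by
          rw [hj]
          simpa using (h _ hi).comp (𝟙 _) (𝟙 _) (G.objObjPreimageIso B).hom
            (G.objObjPreimageIso Y).inv
        simpa [hj] using V.comp_mem (G.objObjPreimageIso B).inv (G.objObjPreimageIso Y).hom hjV

end MorIdeal

/-! ### Conflations under pullback, pushout and biproducts -/

namespace ExactStructure

variable {C : Type u} [Category.{v} C] [Preadditive C] [HasFiniteBiproducts C]
variable {E : ExactStructure C}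

theorem Conf.mono {A B D : C} {k : A ⟶ B} {c : B ⟶ D} (h : E.Conf k c) : Mono k := by
  obtain ⟨w, hw⟩ := h
  obtain ⟨hl⟩ := E.kernel hw
  exact ⟨fun x y hxy => Fork.IsLimit.hom_ext hl hxy⟩

theorem Conf.of_iso {A B D A' B' D' : C} {k : A ⟶ B} {c : B ⟶ D} {k' : A' ⟶ B'} {c' : B' ⟶ D'}
    (h : E.Conf k c) (a : A ≅ A') (b : B ≅ B') (d : D ≅ D') (hk : k ≫ b.hom = a.hom ≫ k')
    (hc : c ≫ d.hom = b.hom ≫ c') : E.Conf k' c' := by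
  obtain ⟨w, hw⟩ := h
  have w' : k' ≫ c' = 0 := by
    rw [← cancel_epi a.hom, ← Category.assoc, ← hk, Category.assoc, ← hc, ← Category.assoc, w]
    simp
  exact ⟨w', E.of_iso (ShortComplex.isoMk a b d hk.symm hc.symm) hw⟩

/-- Deflations are stable under pullback, with the same kernel. -/
theorem Conf.pullback {A B D B' D' : C} {k : A ⟶ B} {c : B ⟶ D} (h : E.Conf k c)
    {m : B' ⟶ B} {c' : B' ⟶ D'} {f : D' ⟶ D} (pb : IsPullback m c' c f) :
    ∃ k' : A ⟶ B', E.Conf k' c' ∧ k' ≫ m = k := by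
  obtain ⟨B₁, m₁, c₁, pb₁, Z, k₁, h₁⟩ := E.pullback_deflation c f ⟨_, _, h⟩
  change E.Conf k₁ c₁ at h₁
  have := h.mono
  have := h₁.mono
  have w := h.1
  have w₁ := h₁.1
  -- The axiom gives some pullback with some kernel. The morphisms `a` and `b` identify that kernel
  -- with `A`; uniqueness of pullbacks then moves the conflation to the given square.
  obtain ⟨a, ha⟩ := h.lift (k₁ ≫ m₁) (by
    rw [Category.assoc, pb₁.w, ← Category.assoc, w₁, zero_comp])
  obtain ⟨b, hb⟩ := h₁.lift (pb₁.lift k 0 (by simp [w])) (by simp)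
  have hab : a ≫ b = 𝟙 _ := by
    rw [← cancel_mono k₁, Category.assoc, hb]
    apply pb₁.hom_ext <;> simp [ha, w₁]
  have hba : b ≫ a = 𝟙 _ := by
    rw [← cancel_mono k, Category.assoc, ha, ← Category.assoc, hb]
    simp
  refine ⟨pb.lift k 0 (by simp [w]), h₁.of_iso ⟨a, b, hab, hba⟩ (pb₁.isoIsPullback _ _ pb)
    (Iso.refl _) ?_ (by simp), by simp⟩
  apply pb.hom_ext <;> simp [ha, w₁]

/-- Inflations are stable under pushout, with the same cokernel. -/
theorem Conf.pushout {A B D A' B' : C} {k : A ⟶ B} {c : B ⟶ D} (h : E.Conf k c)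
    {n : B ⟶ B'} {k' : A' ⟶ B'} {f : A ⟶ A'} (po : IsPushout k f n k') :
    ∃ c' : B' ⟶ D, E.Conf k' c' ∧ n ≫ c' = c := by
  obtain ⟨B₁, n₁, k₁, po₁, Z, c₁, h₁⟩ := E.pushout_inflation k f ⟨_, _, h⟩
  change E.Conf k₁ c₁ at h₁
  have := h.epi
  have := h₁.epi
  have w := h.1
  have w₁ := h₁.1
  obtain ⟨a, ha⟩ := h.desc (n₁ ≫ c₁) (by
    rw [← Category.assoc, po₁.w, Category.assoc, w₁, comp_zero])
  obtain ⟨b, hb⟩ := h₁.desc (po₁.desc c 0 (by simp [w])) (by simp)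
  have hab : a ≫ b = 𝟙 _ := by
    rw [← cancel_epi c, ← Category.assoc, ha, Category.assoc, hb]
    simp
  have hba : b ≫ a = 𝟙 _ := by
    rw [← cancel_epi c₁, ← Category.assoc, hb]
    apply po₁.hom_ext <;> simp [ha, w₁]
  refine ⟨po.desc c 0 (by simp [w]), h₁.of_iso (Iso.refl _) (po₁.isoIsPushout _ _ po)
    ⟨b, a, hba, hab⟩ (by simp) ?_, by simp⟩
  apply po₁.hom_ext <;> simp [hb]

theorem Conf.exists_pullback {A B D D' : C} {k : A ⟶ B} {c : B ⟶ D} (h : E.Conf k c)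
    (f : D' ⟶ D) : ∃ (B' : C) (k' : A ⟶ B') (c' : B' ⟶ D') (m : B' ⟶ B),
      IsPullback m c' c f ∧ E.Conf k' c' ∧ k' ≫ m = k := by
  obtain ⟨B', m, c', pb, -⟩ := E.pullback_deflation c f ⟨_, _, h⟩
  obtain ⟨k', h', hk⟩ := h.pullback pb
  exact ⟨B', k', c', m, pb, h', hk⟩

theorem Conf.exists_pushout {A B D A' : C} {k : A ⟶ B} {c : B ⟶ D} (h : E.Conf k c)
    (f : A ⟶ A') : ∃ (B' : C) (k' : A' ⟶ B') (c' : B' ⟶ D) (n : B ⟶ B'),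
      IsPushout k f n k' ∧ E.Conf k' c' ∧ n ≫ c' = c := by
  obtain ⟨B', n, k', po, -⟩ := E.pushout_inflation k f ⟨_, _, h⟩
  obtain ⟨c', h', hc⟩ := h.pushout po
  exact ⟨B', k', c', n, po, h', hc⟩

section Biproducts

variable [HasBinaryBiproducts C]

/-- The cokernel of the identity of `T` is zero, so this projection is its pullback along a zero
morphism. -/
theorem deflation_biprod_snd (T X : C) : E.Deflation (biprod.snd : T ⊞ X ⟶ X) := by
  obtain ⟨Z, c, hc⟩ := E.id_inflation T
  change E.Conf (𝟙 T) c at hc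
  have hc0 : c = 0 := by simpa using hc.1
  obtain ⟨k', h, -⟩ := hc.pullback (B' := T ⊞ X) (D' := X) (m := biprod.fst) (c' := biprod.snd)
    (f := 0) ⟨⟨by simp [hc0]⟩, ⟨PullbackCone.IsLimit.mk _ (fun s => biprod.lift s.fst s.snd)
      (by simp) (by simp) (fun s m h₁ h₂ => by ext <;> simp [h₁, h₂])⟩⟩
  exact ⟨_, _, h⟩

theorem inflation_biprod_inr (T X : C) : E.Inflation (biprod.inr : X ⟶ T ⊞ X) := by
  obtain ⟨Z, c, hc⟩ := E.id_deflation T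
  change E.Conf c (𝟙 T) at hc
  have hc0 : c = 0 := by simpa using hc.1
  obtain ⟨k', h, -⟩ := hc.pushout (B' := T ⊞ X) (A' := X) (n := biprod.inl) (k' := biprod.inr)
    (f := 0) ⟨⟨by simp [hc0]⟩, ⟨PushoutCocone.IsColimit.mk _ (fun s => biprod.desc s.inl s.inr)
      (by simp) (by simp) (fun s m h₁ h₂ => by ext <;> simp [h₁, h₂])⟩⟩
  exact ⟨_, _, h⟩

/-- The morphism is a shear `T ⊞ P ⟶ T ⊞ X` followed by the projection to `X`. The shear is the
pullback of `p` along `biprod.desc (-f) (𝟙 X)`, hence a deflation. -/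
theorem Deflation.biprod_desc {T P X : C} {p : P ⟶ X} (hp : E.Deflation p) (f : T ⟶ X) :
    E.Deflation (biprod.desc f p) := by
  obtain ⟨K, k, h⟩ := hp
  obtain ⟨k', h', -⟩ := h.pullback (B' := T ⊞ P) (D' := T ⊞ X) (m := biprod.snd)
    (c' := biprod.lift biprod.fst (biprod.desc f p)) (f := biprod.desc (-f) (𝟙 X))
    ⟨⟨by ext <;> simp⟩, ⟨PullbackCone.IsLimit.mk _
      (fun s => biprod.lift (s.snd ≫ biprod.fst) s.fst) (by simp)
      (fun s => by
        have := s.condition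
        ext
        · simp
        · simp [this, biprod.desc_eq])
      (fun s m h₁ h₂ => by ext <;> simp [← h₁, ← h₂])⟩⟩
  have := E.comp_deflation _ _ ⟨_, _, h'⟩ (deflation_biprod_snd T X)
  rwa [biprod.lift_snd] at this

theorem Inflation.biprod_lift {X F Q : C} {q : X ⟶ Q} (hq : E.Inflation q) (f : X ⟶ F) :
    E.Inflation (biprod.lift f q) := by
  obtain ⟨K, c, h⟩ := hq
  obtain ⟨c', h', -⟩ := h.pushout (B' := F ⊞ Q) (A' := F ⊞ X) (n := biprod.inr)
    (k' := biprod.desc biprod.inl (biprod.lift f q)) (f := biprod.lift (-f) (𝟙 X))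
    ⟨⟨by ext <;> simp⟩, ⟨PushoutCocone.IsColimit.mk _
      (fun s => biprod.desc (biprod.inl ≫ s.inr) s.inl) (by simp)
      (fun s => by
        have := s.condition
        ext
        · simp
        · simp [this, biprod.lift_eq])
      (fun s m h₁ h₂ => by ext <;> simp [← h₁, ← h₂])⟩⟩
  have := E.comp_inflation _ _ (inflation_biprod_inr F X) ⟨_, _, h'⟩
  rwa [biprod.inr_desc] at this

end Biproducts

theorem stab_map_eq_zero_iff {A B : C} (f : A ⟶ B) :
    E.stab.map f = 0 ↔ E.FactorsProj f := by
  rw [← E.stab.map_zero, stab_map_eq_iff, sub_zero]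

theorem stab_map_eq_zero_of_proj_right {A P B : C} (hP : E.Proj P) (f : A ⟶ P) (g : P ⟶ B) :
    E.stab.map (f ≫ g) = 0 :=
  (stab_map_eq_zero_iff _).2 ⟨P, f, g, hP, rfl⟩

/-! ### Connecting morphisms and the comparison of `Ext` with stable `Hom` -/

variable [E.IsFrobenius]

/-- A conflation splits if and only if its connecting morphism vanishes in the stable category. -/
theorem Conf.section_iff {Y M X Q S : C} {k : Y ⟶ M} {c : M ⟶ X} {q : Y ⟶ Q} {p : Q ⟶ S}
    (h : E.Conf k c) (h' : E.Conf q p) (hQ : E.Inj Q) {φ : X ⟶ S}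
    (hφ : IsCosyzygyMap k c q p (𝟙 Y) φ) :
    (∃ s : X ⟶ M, s ≫ c = 𝟙 X) ↔ E.stab.map φ = 0 := by
  obtain ⟨e, he, hec⟩ := hφ
  rw [Category.id_comp] at he
  rw [stab_map_eq_zero_iff]
  constructor
  · rintro ⟨s, hs⟩
    refine ⟨Q, s ≫ e, p, (IsFrobenius.proj_iff_inj Q).2 hQ, ?_⟩
    rw [Category.assoc, ← hec, reassoc_of% hs]
  · rintro ⟨P, a, b, hP, rfl⟩
    -- After lifting `b` along `p`, the corrected morphism `e - c ≫ a ≫ t` is killed by `p` and so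
    -- factors through `Y`; the factor `r` is a retraction of `k`.
    obtain ⟨t, ht⟩ := hP p ⟨_, _, h'⟩ b
    obtain ⟨r, hr⟩ := h'.lift (e - c ≫ a ≫ t) (by simp [ht, hec])
    have w := h.1
    have := h'.mono
    have := h.epi
    have hkr : k ≫ r = 𝟙 Y := by
      rw [← cancel_mono q, Category.assoc, hr]
      simp [he, reassoc_of% w]
    obtain ⟨s, hs⟩ := h.desc (𝟙 M - r ≫ k) (by simp [reassoc_of% hkr])
    exact ⟨s, by rw [← cancel_epi c, reassoc_of% hs]; simp [w]⟩

/-- A morphism lifts along a deflation if and only if its composite with the connecting morphism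
vanishes in the stable category. -/
theorem Conf.lift_iff {Y M X Q S X' : C} {k : Y ⟶ M} {c : M ⟶ X} {q : Y ⟶ Q} {p : Q ⟶ S}
    (h : E.Conf k c) (h' : E.Conf q p) (hQ : E.Inj Q) {φ : X ⟶ S}
    (hφ : IsCosyzygyMap k c q p (𝟙 Y) φ) (x : X' ⟶ X) :
    (∃ s : X' ⟶ M, s ≫ c = x) ↔ E.stab.map (x ≫ φ) = 0 := by
  obtain ⟨M', k', c', m, pb, h₁, hm⟩ := h.exists_pullback x
  have hx : IsCosyzygyMap k' c' k c (𝟙 Y) x := ⟨m, by simp [hm], pb.w.symm⟩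
  -- Lifts of `x` along `c` correspond to sections of the pulled back conflation, whose connecting
  -- morphism is `x ≫ φ`.
  rw [← h₁.section_iff h' hQ (by simpa using hx.comp hφ)]
  constructor
  · rintro ⟨s, hs⟩
    exact ⟨pb.lift s (𝟙 _) (by simp [hs]), by simp⟩
  · rintro ⟨s, hs⟩
    exact ⟨s ≫ m, by rw [Category.assoc, pb.w, reassoc_of% hs]⟩

/-- A morphism extends along an inflation if and only if the composite of the connecting morphism
with its cosyzygy vanishes in the stable category. -/
theorem Conf.extend_iff {Y M X Q S Y' Q' S' : C} {k : Y ⟶ M} {c : M ⟶ X} {q : Y ⟶ Q} {p : Q ⟶ S}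
    {q' : Y' ⟶ Q'} {p' : Q' ⟶ S'} (h : E.Conf k c) (h' : E.Conf q' p')
    (hQ' : E.Inj Q') {φ : X ⟶ S} (hφ : IsCosyzygyMap k c q p (𝟙 Y) φ) {y : Y ⟶ Y'} {s : S ⟶ S'}
    (hs : IsCosyzygyMap q p q' p' y s) :
    (∃ t : M ⟶ Y', k ≫ t = y) ↔ E.stab.map (φ ≫ s) = 0 := by
  obtain ⟨M', k', c', n, po, h₁, hn⟩ := h.exists_pushout y
  obtain ⟨ψ, hψ⟩ := exists_cosyzygyMap h₁ h' hQ' (𝟙 Y')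
  have hy : IsCosyzygyMap k c k' c' y (𝟙 X) := ⟨n, po.w, by simp [hn]⟩
  -- Both morphisms complete `y` to a map from `(k, c)` to `(q', p')`, so they agree stably.
  have heq : E.stab.map (φ ≫ s) = E.stab.map ψ :=
    cosyzygyMap_unique h h' hQ' (by simpa using hφ.comp hs) (by simpa using hy.comp hψ) rfl
  rw [heq, ← h₁.section_iff h' hQ' hψ]
  have hw := h₁.1
  have := h₁.mono
  have := h₁.epi
  constructor
  · rintro ⟨t, ht⟩
    obtain ⟨a, ha⟩ := h₁.desc (𝟙 M' - po.desc t (𝟙 _) (by simp [ht]) ≫ k') (by simp)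
    exact ⟨a, by rw [← cancel_epi c', reassoc_of% ha]; simp [hw]⟩
  · rintro ⟨a, ha⟩
    obtain ⟨r, hr⟩ := h₁.lift (𝟙 M' - c' ≫ a) (by simp [ha])
    refine ⟨n ≫ r, ?_⟩
    rw [← cancel_mono k']
    simp [hr, po.w_assoc, reassoc_of% hw]

/-- Cosyzygies of the same object are isomorphic in the stable category. -/
theorem stab_map_comp_eq_id {A Q S Q' S' : C} {k : A ⟶ Q} {c : Q ⟶ S} {k' : A ⟶ Q'} {c' : Q' ⟶ S'}
    (h : E.Conf k c) (hQ : E.Inj Q) {s : S ⟶ S'} {t : S' ⟶ S}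
    (hs : IsCosyzygyMap k c k' c' (𝟙 A) s) (ht : IsCosyzygyMap k' c' k c (𝟙 A) t) :
    E.stab.map s ≫ E.stab.map t = 𝟙 _ := by
  rw [← E.stab.map_comp, ← E.stab.map_id]
  exact cosyzygyMap_unique h h hQ (hs.comp ht) (f' := 𝟙 A) ⟨𝟙 _, by simp, by simp⟩ (by simp)

/-- `Ext` of two morphisms vanishes if and only if `Hom` of the first and of the cosyzygy of the
second vanishes in the stable category. -/
theorem extOrthogonal_iff {X A B Y : C} (f : X ⟶ A) (g : B ⟶ Y) :
    E.ExtOrthogonal f g ↔ MorIdeal.HomOrthogonal (E.stab.map f) (E.sigma.map g) := by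
  obtain ⟨s, hs⟩ := E.exists_isSigma g
  constructor
  · intro h x
    obtain ⟨x, rfl⟩ := E.stab.map_surjective (X := A) (Y := E.cosyz B) x
    -- Pulling back the fixed conflation of `B` realizes the given `x` as a connecting morphism.
    obtain ⟨M, k, c, m, pb, h₁, hm⟩ := (E.cosyz_conf B).exists_pullback x
    obtain ⟨M', k', c', m', pb', h₂, hm'⟩ := h₁.exists_pullback f
    obtain ⟨M'', k'', c'', n, po, h₃, hn⟩ := h₂.exists_pushout g
    obtain ⟨ψ, hψ⟩ := exists_cosyzygyMap h₃ (E.cosyz_conf Y) (E.injHull_inj Y) (𝟙 Y)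
    have h0 := (h₃.section_iff (E.cosyz_conf Y) (E.injHull_inj Y) hψ).1
      (h k c k' c' k'' c'' m' n h₁ h₂ h₃ pb' hm' po hn)
    have h₄ : IsCosyzygyMap k' c' k'' c'' g (𝟙 X) := ⟨n, po.w, by simp [hn]⟩
    have h₅ : IsCosyzygyMap k' c' k c (𝟙 B) f := ⟨m', by simp [hm'], pb'.w.symm⟩
    have h₆ : IsCosyzygyMap k c (E.cosyzι B) (E.cosyzπ B) (𝟙 B) x := ⟨m, by simp [hm], pb.w.symm⟩
    -- Over `g` there are two maps from `(k', c')` to the fixed conflation of `Y`: through the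
    -- pullbacks and `Σ(g)`, and through the pushout. Hence `f ≫ x ≫ s` and `ψ` agree stably.
    have := cosyzygyMap_unique h₂ (E.cosyz_conf Y) (E.injHull_inj Y) ((h₅.comp h₆).comp hs)
      (h₄.comp hψ) (by simp)
    rw [E.sigma_map hs]
    refine (?_ : _ = E.stab.map ((f ≫ x) ≫ s)).trans (this.trans ?_)
    · rw [E.stab.map_comp, E.stab.map_comp, Category.assoc]; rfl
    · rw [Category.id_comp]
      exact h0
  · intro h M M' M'' k c k' c' k'' c'' m n h₁ h₂ h₃ pb hm po hn
    obtain ⟨x, hx⟩ := exists_cosyzygyMap h₁ (E.cosyz_conf B) (E.injHull_inj B) (𝟙 B)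
    obtain ⟨ψ, hψ⟩ := exists_cosyzygyMap h₃ (E.cosyz_conf Y) (E.injHull_inj Y) (𝟙 Y)
    have h₄ : IsCosyzygyMap k' c' k'' c'' g (𝟙 X) := ⟨n, po.w, by simp [hn]⟩
    have h₅ : IsCosyzygyMap k' c' k c (𝟙 B) f := ⟨m, by simp [hm], pb.w.symm⟩
    have := cosyzygyMap_unique h₂ (E.cosyz_conf Y) (E.injHull_inj Y) ((h₅.comp hx).comp hs)
      (h₄.comp hψ) (by simp)
    rw [h₃.section_iff (E.cosyz_conf Y) (E.injHull_inj Y) hψ]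
    have h0 := h (E.stab.map x)
    rw [E.sigma_map hs] at h0
    rw [← Category.id_comp ψ, ← this, E.stab.map_comp, E.stab.map_comp, Category.assoc]
    exact h0

end ExactStructure

/-! ### Triangles and the correspondence of pairs -/

namespace ExactStructure

variable {C : Type u} [Category.{v} C] [Preadditive C] [HasFiniteBiproducts C]
variable {E : ExactStructure C}

theorem exists_isPrecover_stable {I : MorIdeal C}
    (h : ∀ X : C, ∃ (T : C) (i : T ⟶ X), I.IsPrecover i) (X : E.Stable) :
    ∃ (T : E.Stable) (i : T ⟶ X), (I.image E.stab).IsPrecover i := by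
  obtain ⟨T, i, hi, hT⟩ := h X.as
  refine ⟨E.stab.obj T, E.stab.map i, MorIdeal.map_mem_image E.stab hi, fun T' i' hi' => ?_⟩
  obtain ⟨i', rfl⟩ := E.stab.map_surjective (X := T'.as) (Y := X.as) i'
  -- The chosen lift `i'` need not lie in `I`, so it is exchanged for a stably equal `i''` that
  -- does.
  obtain ⟨i'', hi'', h⟩ := MorIdeal.exists_of_map_mem_image E.stab hi'
  obtain ⟨t, rfl⟩ := hT i'' hi''
  exact ⟨E.stab.map t, (E.stab.map_comp t i).symm.trans h.symm⟩

variable [E.IsFrobenius]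

/-- Every morphism of the stable category is the first morphism of a distinguished triangle. -/
theorem exists_stableWeakConf_right {X Y : E.Stable} (x : X ⟶ Y) :
    ∃ (Z : E.Stable) (y : Y ⟶ Z), E.StableWeakConf x y := by
  obtain ⟨f, rfl⟩ := E.stab.map_surjective (X := X.as) (Y := Y.as) x
  obtain ⟨D, g, w, q, po, h, hq⟩ := (E.cosyz_conf X.as).exists_pushout f
  refine ⟨E.stab.obj D, E.stab.map g, E.stab.map w, X.as, Y.as, D, f, g, q, w, Iso.refl _,
    Iso.refl _, Iso.refl _, po, hq, h.1, ?_, ?_, ?_⟩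
  · exact (Category.comp_id _).trans (Category.id_comp _).symm
  · exact (Category.comp_id _).trans (Category.id_comp _).symm
  · refine Eq.trans ?_ (Category.id_comp _).symm
    exact (congrArg _ (E.stableShift.map_id _)).trans (Category.comp_id _)

/-- Every morphism of the stable category is the second morphism of a distinguished triangle. -/
theorem exists_stableWeakConf_left {Y Z : E.Stable} (y : Y ⟶ Z) :
    ∃ (X : E.Stable) (x : X ⟶ Y), E.StableWeakConf x y := by
  obtain ⟨A, ⟨b₀⟩⟩ := Functor.EssSurj.mem_essImage (F := E.sigma) Y
  obtain ⟨B, ⟨d₀⟩⟩ := Functor.EssSurj.mem_essImage (F := E.sigma) Z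
  obtain ⟨g, hg⟩ := E.sigma.map_surjective (b₀.hom ≫ y ≫ d₀.inv)
  obtain ⟨D, j, w, q, po, h, hq⟩ := (E.cosyz_conf A).exists_pushout g
  -- Up to isomorphism `y` is `Σ(g)`. Embedding `B` through `D` into the injective hull of `D` makes
  -- `N` another cosyzygy of `B`, and `r` will represent `Σ(g)`. The standard triangle on `w` then
  -- has `r` as its second morphism.
  obtain ⟨N, c, hc⟩ := E.comp_inflation _ _ ⟨_, _, h⟩ ⟨_, _, E.cosyz_conf D⟩
  change E.Conf _ c at hc
  have hjc := hc.1
  rw [Category.assoc] at hjc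
  obtain ⟨r, hr⟩ := h.desc (E.cosyzι D ≫ c) hjc
  have := h.epi
  have := hc.epi
  have hw := h.1
  have hs₀ (s : PushoutCocone (E.cosyzι D) w) : (j ≫ E.cosyzι D) ≫ s.inl = 0 := by
    rw [Category.assoc, s.condition, reassoc_of% hw, zero_comp]
  -- A cocone kills the inflation of `B`, hence factors through its cokernel `N`; compatibility with
  -- `r` is checked after the epimorphism `w`.
  have po' : IsPushout (E.cosyzι D) w c r :=
    ⟨⟨hr.symm⟩, ⟨PushoutCocone.IsColimit.mk _
      (fun s => (hc.desc s.inl (hs₀ s)).choose)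
      (fun s => (hc.desc s.inl (hs₀ s)).choose_spec)
      (fun s => by
        rw [← cancel_epi w, reassoc_of% hr, (hc.desc s.inl (hs₀ s)).choose_spec, s.condition])
      (fun s m h₁ h₂ => by
        rw [← cancel_epi c, h₁, (hc.desc s.inl (hs₀ s)).choose_spec])⟩⟩
  obtain ⟨w', hw', hcw'⟩ := (E.cosyz_conf D).pushout po'
  obtain ⟨n, hn⟩ := exists_cosyzygyMap hc (E.cosyz_conf B) (E.injHull_inj B) (𝟙 B)
  obtain ⟨n', hn'⟩ := exists_cosyzygyMap (E.cosyz_conf B) hc (E.injHull_inj D) (𝟙 B)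
  obtain ⟨e, he⟩ : ∃ e : E.stab.obj N ≅ E.sigma.obj B, e.hom = E.stab.map n :=
    ⟨⟨E.stab.map n, E.stab.map n', stab_map_comp_eq_id hc (E.injHull_inj D) hn hn',
      stab_map_comp_eq_id (E.cosyz_conf B) (E.injHull_inj B) hn' hn⟩, rfl⟩
  have hgr : IsCosyzygyMap (E.cosyzι A) (E.cosyzπ A) (j ≫ E.cosyzι D) c g r :=
    ⟨q ≫ E.cosyzι D, by rw [reassoc_of% po.w], by rw [Category.assoc, ← hr, reassoc_of% hq]⟩
  let ρ : E.sigma.obj A ⟶ E.stab.obj N := E.stab.map r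
  have hgρ : E.sigma.map g = ρ ≫ e.hom := by
    have := hgr.comp hn
    rw [Category.comp_id] at this
    rw [he]
    exact (E.sigma_map this).trans (E.stab.map_comp r n)
  have hρ : y ≫ d₀.inv ≫ e.inv = b₀.inv ≫ ρ := by
    rw [hgρ] at hg
    rw [Iso.eq_inv_comp, ← (Iso.comp_inv_eq e).2 hg.symm]
    simp
  refine ⟨E.stab.obj D, E.stab.map w ≫ b₀.hom, d₀.inv ≫ e.inv ≫ E.stab.map w',
    D, E.cosyz A, N, w, r, c, w', Iso.refl _, b₀.symm, d₀.symm ≪≫ e.symm, po', hcw', hw'.1,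
    ?_, ?_, ?_⟩
  · exact (Category.assoc _ _ _).trans ((congrArg (E.stab.map w ≫ ·) b₀.hom_inv_id).trans
      ((Category.comp_id _).trans (Category.id_comp _).symm))
  · exact hρ
  · refine (congrArg _ (E.stableShift.map_id _)).trans ((Category.comp_id _).trans ?_)
    exact (Category.assoc _ _ _).symm

/-- Once `Ext` is rewritten as stable `Hom`, membership in either ideal depends only on the image
under `π` or `Σ`. This gives both saturation equalities, which then identify the orthogonality
conditions in `C` with those in the stable category. -/
theorem isCotorsionPair_iff (I J : MorIdeal C) : E.IsCotorsionPair I J ↔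
    (I.image E.stab).comap E.stab = I ∧ (J.image E.sigma).comap E.sigma = J ∧
      MorIdeal.IsTorsionPair (I.image E.stab) (J.image E.sigma) := by
  simp only [IsCotorsionPair, extOrthogonal_iff]
  rw [MorIdeal.isTorsionPair_iff_comap E.stab E.sigma]
  constructor
  · rintro ⟨hI, hJ⟩
    have h₁ : (I.image E.stab).comap E.stab = I :=
      MorIdeal.comap_image E.stab fun A B f g h hg => by
        rw [hI] at hg ⊢
        rwa [h]
    have h₂ : (J.image E.sigma).comap E.sigma = J :=
      MorIdeal.comap_image E.sigma fun A B f g h hg => by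
        rw [hJ] at hg ⊢
        rwa [h]
    rw [h₁, h₂]
    exact ⟨rfl, rfl, hI, hJ⟩
  · rintro ⟨h₁, h₂, h⟩
    rwa [h₁, h₂] at h

theorem bijOn_image :
    Set.BijOn
      (fun p : MorIdeal C × MorIdeal C => (p.1.image E.stab, p.2.image E.sigma))
      {p | E.IsCotorsionPair p.1 p.2}
      {q : MorIdeal E.Stable × MorIdeal E.Stable | MorIdeal.IsTorsionPair q.1 q.2} := by
  refine Set.InvOn.bijOn (f' := fun q => (q.1.comap E.stab, q.2.comap E.sigma)) ⟨?_, ?_⟩ ?_ ?_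
  · rintro ⟨I, J⟩ h
    have h := (isCotorsionPair_iff I J).1 h
    exact Prod.ext h.1 h.2.1
  · rintro ⟨U, V⟩ h
    exact Prod.ext (MorIdeal.image_comap _ _) (MorIdeal.image_comap _ _)
  · rintro ⟨I, J⟩ h
    exact ((isCotorsionPair_iff I J).1 h).2.2
  · rintro ⟨U, V⟩ h
    refine (isCotorsionPair_iff _ _).2 ?_
    simp only [MorIdeal.image_comap]
    exact ⟨trivial, trivial, h⟩

/-! ### Special approximations and completeness -/

/-- An `Ext`-special precover is a precover in the exact category. -/
theorem IsExtSpecialPrecover.isPrecover {I : MorIdeal C} {T X : C} {i : T ⟶ X}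
    (h : E.IsExtSpecialPrecover I i) : I.IsPrecover i := by
  obtain ⟨hi, K, P, F, k, p, l, g, m, hP, hk, hl, hg, hm, hI⟩ := h
  refine ⟨hi, fun T' i' hi' => ?_⟩
  obtain ⟨φ, hφ⟩ := exists_cosyzygyMap hk (E.cosyz_conf K) (E.injHull_inj K) (𝟙 K)
  obtain ⟨ψ, hψ⟩ := exists_cosyzygyMap hl (E.cosyz_conf F) (E.injHull_inj F) (𝟙 F)
  obtain ⟨s, hs⟩ := E.exists_isSigma g
  rw [hl.lift_iff (E.cosyz_conf F) (E.injHull_inj F) hψ, E.stab.map_comp]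
  have hgm : IsCosyzygyMap k p l i g (𝟙 X) := ⟨m, hg.symm, by simp [hm]⟩
  -- The obstruction `i' ≫ ψ` to lifting is stably `i' ≫ φ ≫ Σ(g)`, which vanishes because `Ext(i',
  -- g) = 0`.
  have h₁ : E.stab.map (φ ≫ s) = E.stab.map (𝟙 X ≫ ψ) :=
    cosyzygyMap_unique hk (E.cosyz_conf F) (E.injHull_inj F) (hφ.comp hs) (hgm.comp hψ) (by simp)
  rw [Category.id_comp, E.stab.map_comp] at h₁
  rw [← h₁, ← E.sigma_map hs]
  exact (extOrthogonal_iff _ _).1 (hI i' hi') (E.stab.map φ)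

/-- An `Ext`-special preenvelope is a preenvelope in the exact category. -/
theorem IsExtSpecialPreenvelope.isPreenvelope {J : MorIdeal C} {X F : C} {j : X ⟶ F}
    (h : E.IsExtSpecialPreenvelope J j) : J.IsPreenvelope j := by
  obtain ⟨hj, T, Q, K, q, c, d, g, m, hQ, hq, hd, hg, hm, hJ⟩ := h
  refine ⟨hj, fun F' j' hj' => ?_⟩
  obtain ⟨ψ, hψ⟩ := exists_cosyzygyMap hq (E.cosyz_conf X) (E.injHull_inj X) (𝟙 X)
  obtain ⟨s, hs⟩ := E.exists_isSigma j'
  -- The connecting morphism of `(j, d)` factors through `g`, so the obstruction to extending `j'`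
  -- has the form `g ≫ ψ ≫ Σ(j')`.
  have hgm : IsCosyzygyMap j d q c (𝟙 X) g := ⟨m, by simp [hm], hg⟩
  have h₁ : IsCosyzygyMap j d (E.cosyzι X) (E.cosyzπ X) (𝟙 X) (g ≫ ψ) := by
    simpa using hgm.comp hψ
  rw [hd.extend_iff (E.cosyz_conf F') (E.injHull_inj F') h₁ hs, E.stab.map_comp, E.stab.map_comp,
    Category.assoc, ← E.sigma_map hs]
  exact (extOrthogonal_iff _ _).1 (hJ j' hj') (E.stab.map ψ)

theorem exists_isPreenvelope_stable {J : MorIdeal C}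
    (h : ∀ X : C, ∃ (F : C) (j : X ⟶ F), J.IsPreenvelope j) (X : E.Stable) :
    ∃ (F : E.Stable) (j : X ⟶ F), (J.image E.sigma).IsPreenvelope j := by
  let a := E.sigma.objObjPreimageIso X
  obtain ⟨F, j, hj, hF⟩ := h (E.sigma.objPreimage X)
  refine ⟨E.sigma.obj F, a.inv ≫ E.sigma.map j,
    MorIdeal.comp_left_mem _ _ (MorIdeal.map_mem_image E.sigma hj), fun F' j' hj' => ?_⟩
  let b := E.sigma.objObjPreimageIso F'
  obtain ⟨f, hf⟩ := E.sigma.map_surjective (a.hom ≫ j' ≫ b.inv)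
  obtain ⟨j'', hj'', h⟩ := MorIdeal.exists_of_map_mem_image E.sigma
    (hf ▸ MorIdeal.comp_mem _ a.hom b.inv hj')
  obtain ⟨t, rfl⟩ := hF j'' hj''
  refine ⟨E.sigma.map t ≫ b.hom, ?_⟩
  rw [E.sigma.map_comp, hf] at h
  rw [Category.assoc, ← reassoc_of% h]
  simp

theorem IsCotorsionPair.mem_left_iff {I J : MorIdeal C} (h : E.IsCotorsionPair I J) {A B : C}
    (f : A ⟶ B) : E.stab.map f ∈ (I.image E.stab).hom _ _ ↔ f ∈ I.hom A B := by
  rw [← MorIdeal.mem_comap, ((isCotorsionPair_iff I J).1 h).1]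

theorem IsCotorsionPair.mem_right_iff {I J : MorIdeal C} (h : E.IsCotorsionPair I J) {A B : C}
    (f : A ⟶ B) : E.sigma.map f ∈ (J.image E.sigma).hom _ _ ↔ f ∈ J.hom A B := by
  rw [← MorIdeal.mem_comap, ((isCotorsionPair_iff I J).1 h).2.1]

/-- A stable precover `i₀` is made a deflation by adding a projective `P ⟶ X`. The inclusion of `P`
induces `g` on kernels, and composing any morphism `A' ⟶ Σ(K)` with `Σ(g)` amounts to composing a
morphism `A' ⟶ X` with the connecting morphism `ψ`, which kills `i₀`. -/
theorem exists_isExtSpecialPrecover {I J : MorIdeal C} (hIJ : E.IsCotorsionPair I J)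
    (h : ∀ X : E.Stable, ∃ (T : E.Stable) (i : T ⟶ X), (I.image E.stab).IsPrecover i) (X : C) :
    ∃ (T : C) (i : T ⟶ X), E.IsExtSpecialPrecover I i := by
  have : HasBinaryBiproducts C := hasBinaryBiproducts_of_finite_biproducts C
  obtain ⟨T, u, hu, hT⟩ := h (E.stab.obj X)
  obtain ⟨i₀, rfl⟩ := E.stab.map_surjective (X := T.as) (Y := X) u
  obtain ⟨P, p, hP, hp⟩ := IsFrobenius.enough_proj (E := E) X
  obtain ⟨F, l, hl⟩ := hp.biprod_desc i₀
  obtain ⟨K, k, hk⟩ := hp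
  have w := hk.1
  have hP' := (IsFrobenius.proj_iff_inj P).1 hP
  obtain ⟨g, hg⟩ := hl.lift (k ≫ biprod.inr) (by simp [w])
  have hi₀ : i₀ ∈ I.hom _ _ := (hIJ.mem_left_iff _).1 hu
  refine ⟨T.as ⊞ P, biprod.desc i₀ p, ?_, K, P, F, k, p, l, g, biprod.inr, hP, hk, hl, hg,
    by simp, ?_⟩
  · have hp : p ∈ I.hom _ _ := (hIJ.mem_left_iff p).1 (by
      rw [← Category.id_comp p, stab_map_eq_zero_of_proj_right hP]
      exact AddSubgroup.zero_mem _)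
    rw [biprod.desc_eq]
    exact AddSubgroup.add_mem _ (I.comp_left_mem _ hi₀) (I.comp_left_mem _ hp)
  · intro X' A' i' hi'
    rw [extOrthogonal_iff]
    intro x
    obtain ⟨x, rfl⟩ := E.stab.map_surjective (X := A') (Y := E.cosyz K) x
    obtain ⟨φ, hφ⟩ := exists_cosyzygyMap hk (E.cosyz_conf K) (E.injHull_inj K) (𝟙 K)
    -- As `P` is also injective, `X` is a cosyzygy of `K`; `φ'` carries `x` to a morphism into `X`,
    -- where the precover property applies.
    obtain ⟨φ', hφ'⟩ := exists_cosyzygyMap (E.cosyz_conf K) hk hP' (𝟙 K)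
    obtain ⟨ψ, hψ⟩ := exists_cosyzygyMap hl (E.cosyz_conf F) (E.injHull_inj F) (𝟙 F)
    obtain ⟨s, hs⟩ := E.exists_isSigma g
    have hφφ' := stab_map_comp_eq_id (E.cosyz_conf K) (E.injHull_inj K) hφ' hφ
    have hgm : IsCosyzygyMap k p l (biprod.desc i₀ p) g (𝟙 X) := ⟨biprod.inr, hg.symm, by simp⟩
    have h₁ : E.stab.map (φ ≫ s) = E.stab.map (𝟙 X ≫ ψ) :=
      cosyzygyMap_unique hk (E.cosyz_conf F) (E.injHull_inj F) (hφ.comp hs) (hgm.comp hψ)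
        (by simp)
    rw [Category.id_comp, E.stab.map_comp] at h₁
    obtain ⟨t, ht⟩ := hT (E.stab.map (i' ≫ x ≫ φ'))
      (MorIdeal.map_mem_image E.stab (I.comp_right_mem _ hi'))
    have h₂ : E.stab.map (biprod.desc i₀ p ≫ ψ) = 0 :=
      (hl.lift_iff (E.cosyz_conf F) (E.injHull_inj F) hψ _).1 ⟨𝟙 _, by simp⟩
    have h₃ : E.stab.map i₀ ≫ E.stab.map ψ = 0 := by
      rw [← E.stab.map_comp, ← biprod.inl_desc i₀ p, Category.assoc, E.stab.map_comp, h₂,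
        comp_zero]
    rw [E.sigma_map hs]
    have h₄ : E.stab.map x = E.stab.map x ≫ E.stab.map φ' ≫ E.stab.map φ := by
      rw [hφφ', Category.comp_id]
    calc E.stab.map i' ≫ E.stab.map x ≫ E.stab.map s
        = E.stab.map i' ≫ (E.stab.map x ≫ E.stab.map φ' ≫ E.stab.map φ) ≫ E.stab.map s := by
          rw [← h₄]
      _ = E.stab.map (i' ≫ x ≫ φ') ≫ E.stab.map φ ≫ E.stab.map s := by
          simp only [E.stab.map_comp, Category.assoc]
      _ = 0 := by rw [h₁, ← ht, Category.assoc, h₃, comp_zero]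

theorem sigma_map_eq_zero_of_inj {A Q B : C} (hQ : E.Inj Q) (f : A ⟶ Q) (g : Q ⟶ B) :
    E.sigma.map (f ≫ g) = 0 := by
  have h : E.stab.map (f ≫ g) = E.stab.map 0 := by
    rw [E.stab.map_zero]
    exact stab_map_eq_zero_of_proj_right ((IsFrobenius.proj_iff_inj Q).2 hQ) f g
  -- By definition `Σ` is `π` followed by `stableShift`.
  exact (congrArg E.stableShift.map h).trans (E.sigma.map_zero _ _)

/-- Dual to the precover case, except that the stable preenvelope is taken of `Σ(X)`, since the
torsion-free ideal is the image of `J` under `Σ`. -/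
theorem exists_isExtSpecialPreenvelope {I J : MorIdeal C} (hIJ : E.IsCotorsionPair I J)
    (h : ∀ X : E.Stable, ∃ (F : E.Stable) (j : X ⟶ F), (J.image E.sigma).IsPreenvelope j)
    (X : C) : ∃ (F : C) (j : X ⟶ F), E.IsExtSpecialPreenvelope J j := by
  have : HasBinaryBiproducts C := hasBinaryBiproducts_of_finite_biproducts C
  obtain ⟨Y, v, hv, hY⟩ := h (E.sigma.obj X)
  obtain ⟨F, ⟨b⟩⟩ := Functor.EssSurj.mem_essImage (F := E.sigma) Y
  obtain ⟨j₀, hj₀⟩ := E.sigma.map_surjective (v ≫ b.inv)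
  obtain ⟨Q, q, hQ, hq⟩ := IsFrobenius.enough_inj (E := E) X
  obtain ⟨T, d, hd⟩ := hq.biprod_lift j₀
  obtain ⟨K, c, hc⟩ := hq
  have w := hc.1
  obtain ⟨g, hg⟩ := hd.desc (biprod.snd ≫ c) (by simp [w])
  have hj₀J : j₀ ∈ J.hom _ _ := (hIJ.mem_right_iff _).1 (by
    rw [hj₀]
    exact MorIdeal.comp_right_mem _ _ hv)
  refine ⟨F ⊞ Q, biprod.lift j₀ q, ?_, T, Q, K, q, c, d, g, biprod.snd, hQ, hc, hd, hg,
    by simp, ?_⟩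
  · have hq : q ∈ J.hom _ _ := (hIJ.mem_right_iff q).1 (by
      rw [← Category.comp_id q, sigma_map_eq_zero_of_inj hQ]
      exact AddSubgroup.zero_mem _)
    rw [biprod.lift_eq]
    exact AddSubgroup.add_mem _ (J.comp_right_mem _ hj₀J) (J.comp_right_mem _ hq)
  · intro B' Y' j' hj'
    rw [extOrthogonal_iff]
    intro x
    obtain ⟨ψ, hψ⟩ := exists_cosyzygyMap hc (E.cosyz_conf X) (E.injHull_inj X) (𝟙 X)
    obtain ⟨ψ', hψ'⟩ := exists_cosyzygyMap (E.cosyz_conf X) hc hQ (𝟙 X)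
    let Ψ : E.stab.obj K ⟶ E.sigma.obj X := E.stab.map ψ
    let Ψ' : E.sigma.obj X ⟶ E.stab.obj K := E.stab.map ψ'
    have hΨ : Ψ ≫ Ψ' = 𝟙 _ := stab_map_comp_eq_id hc hQ hψ hψ'
    -- Moving the source of `x` from `K` to `Σ(X)` and using fullness of `Σ` gives `y` with `y ≫ j'`
    -- in `J`, so its cosyzygy factors through the preenvelope `v`.
    obtain ⟨y, hy⟩ := E.sigma.map_surjective (Ψ' ≫ x)
    obtain ⟨τ, hτ⟩ := hY (E.sigma.map (y ≫ j'))
      (MorIdeal.map_mem_image E.sigma (J.comp_left_mem _ hj'))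
    have hgm : IsCosyzygyMap (biprod.lift j₀ q) d q c (𝟙 X) g := ⟨biprod.snd, by simp, hg⟩
    obtain ⟨s, hs⟩ := E.exists_isSigma j₀
    have h₁ : IsCosyzygyMap (biprod.lift j₀ q) d (E.cosyzι X) (E.cosyzπ X) (𝟙 X) (g ≫ ψ) := by
      simpa using hgm.comp hψ
    -- The projection `biprod.fst` extends `j₀` along the inflation, so its obstruction vanishes.
    have h₂ : E.stab.map ((g ≫ ψ) ≫ s) = 0 :=
      (hd.extend_iff (E.cosyz_conf F) (E.injHull_inj F) h₁ hs).1 ⟨biprod.fst, by simp⟩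
    have h₃ : E.stab.map g ≫ Ψ ≫ E.sigma.map j₀ = 0 := by
      rw [E.stab.map_comp, E.stab.map_comp, Category.assoc] at h₂
      rw [E.sigma_map hs]
      exact h₂
    have hv' : v = E.sigma.map j₀ ≫ b.hom := by simp [hj₀]
    have hx : x = Ψ ≫ E.sigma.map y := by rw [hy, reassoc_of% hΨ]
    calc E.stab.map g ≫ x ≫ E.sigma.map j'
        = (E.stab.map g ≫ Ψ ≫ E.sigma.map j₀) ≫ b.hom ≫ τ := by
          rw [E.sigma.map_comp, hv'] at hτ
          simp only [hx, Category.assoc, ← hτ]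
      _ = 0 := by rw [h₃, zero_comp]

theorem IsCotorsionPair.complete_iff {I J : MorIdeal C} (hIJ : E.IsCotorsionPair I J) :
    E.IsCompleteCotorsionPair I J ↔
      MorIdeal.IsCompleteTorsionPair E.StableWeakConf (I.image E.stab) (J.image E.sigma) := by
  constructor
  · rintro ⟨-, h₁, h₂⟩
    refine ⟨((isCotorsionPair_iff I J).1 hIJ).2.2, fun X => ?_, fun X => ?_⟩
    · obtain ⟨T, i, hi⟩ := exists_isPrecover_stable
        (fun X => (h₁ X).imp fun _ => Exists.imp fun _ => IsExtSpecialPrecover.isPrecover) X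
      exact ⟨T, i, hi, exists_stableWeakConf_right i⟩
    · obtain ⟨F, j, hj⟩ := exists_isPreenvelope_stable
        (fun X => (h₂ X).imp fun _ => Exists.imp fun _ => IsExtSpecialPreenvelope.isPreenvelope) X
      exact ⟨F, j, hj, exists_stableWeakConf_left j⟩
  · rintro ⟨-, h₁, h₂⟩
    exact ⟨hIJ,
      exists_isExtSpecialPrecover hIJ fun X => (h₁ X).imp fun _ => Exists.imp fun _ h => h.1,
      exists_isExtSpecialPreenvelope hIJ fun X => (h₂ X).imp fun _ => Exists.imp fun _ h => h.1⟩

end ExactStructure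

theorem theoremT {C : Type u} [Category.{v} C] [Preadditive C] [HasFiniteBiproducts C]
    (E : ExactStructure C) [E.IsFrobenius] :
    Set.BijOn
      (fun p : MorIdeal C × MorIdeal C => (p.1.image E.stab, p.2.image E.sigma))
      {p | E.IsCotorsionPair p.1 p.2}
      {q : MorIdeal E.Stable × MorIdeal E.Stable | MorIdeal.IsTorsionPair q.1 q.2} ∧
    ∀ I J : MorIdeal C, E.IsCotorsionPair I J →
      (E.IsCompleteCotorsionPair I J ↔
        MorIdeal.IsCompleteTorsionPair E.StableWeakConf (I.image E.stab) (J.image E.sigma)) :=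
  ⟨ExactStructure.bijOn_image, fun _ _ hIJ => hIJ.complete_iff⟩
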